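/- Conventions. A polytope in $\mathbb R^n$ is the convex hull of finitely many points; its faces are the sets of maximizers of linear functionals over it, and its vertices and edges are its faces of dimension $0$ and $1$. The direction of an edge with endpoints $u\ne v$ is the line $\mathbb R(v-u)$, so parallel edges have the same direction. The zonotope generated by vectors $v^1,\dots,v^m\in\mathbb R^n$ is the Minkowski sum $Z(v^1,\dots,v^m)=\sum_{i=1}^m[0,v^i]$ (which is $\{0\}$ if $m=0$). For a polytope $P$, a vector $c\in\mathbb R^n$ is a nondegenerate objective function if no two vertices of $P$ have the same value of $c^\top x$. For such a $c$, a $c$-monotone path on $P$ is a path in the graph of vertices and edges of $P$ that starts at some vertex, along which $c^\top x$ strictly decreases at each step, and which ends at the vertex of $P$ minimizing $c^\top x$ over $P$; its length is its number of edges. The $c$-monotone diameter of $P$ is the maximum, over all starting vertices, of the length of a shortest $c$-monotone path from that vertex, and the monotone diameter $\text{mono-diam}(P)$ is the maximum of the $c$-monotone diameters over all nondegenerate objective functions $c$. Theorem. (a) Let $P\subset\mathbb R^n$ be a polytope, let $E$ be an inclusion-minimal finite set of vectors such that every edge direction of $P$ is spanned by a vector of $E$, and let $Z(P)$ be the zonotope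 generated by $E$. Then $$\text{mono-diam}(P)\le \text{mono-diam}(Z(P)) = \text{the number of distinct edge directions of } P .$$ (b) For any vectors $v^1,\dots,v^m\in\mathbb R^n$ and any nondegenerate objective function $c$ on $Z(v^1,\dots,v^m)$, every $c$-monotone path on $Z(v^1,\dots,v^m)$ has length at most $m$. -/

import Mathlib

open scoped Pointwise ENat

/-- A (convex) polytope in `ℝⁿ`: the convex hull of finitely many points. -/
def IsPolytope {n : ℕ} (P : Set (Fin n → ℝ)) : Prop :=
  ∃ S : Set (Fin n → ℝ), S.Finite ∧ P = convexHull ℝ S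

/-- The vertices of `P`: its zero-dimensional faces, i.e. the points of `P` at which some linear
functional attains its maximum over `P` uniquely. -/
def vertices {n : ℕ} (P : Set (Fin n → ℝ)) : Set (Fin n → ℝ) :=
  P.exposedPoints ℝ

/-- `u` and `v` are the two endpoints of an edge of `P`: they are distinct vertices of `P` and the
segment joining them is a face of `P` (the set of maximizers over `P` of a linear functional). -/
def IsEdge {n : ℕ} (P : Set (Fin n → ℝ)) (u v : Fin n → ℝ) : Prop :=
  u ∈ vertices P ∧ v ∈ vertices P ∧ u ≠ v ∧ IsExposed ℝ P (segment ℝ u v)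

/-- The set of edge directions of `P`; the direction of the edge with endpoints `u` and `v` is the
line through the origin spanned by `v - u`, so that parallel edges have the same direction. -/
def edgeDirections {n : ℕ} (P : Set (Fin n → ℝ)) : Set (Submodule ℝ (Fin n → ℝ)) :=
  {L | ∃ u v, IsEdge P u v ∧ L = Submodule.span ℝ {v - u}}

/-- The finite set of vectors `E` contains all directions of edges of `P`: each edge direction of
`P` is spanned by a member of `E`. -/
def ContainsEdgeDirections {n : ℕ} (P : Set (Fin n → ℝ)) (E : Finset (Fin n → ℝ)) : Prop :=
  ∀ L ∈ edgeDirections P, ∃ e ∈ E, Submodule.span ℝ {e} = L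

/-- The zonotope generated by a finite family of vectors: the Minkowski sum of the segments from
`0` to `v i`. -/
def zonotope {n : ℕ} {ι : Type*} [Fintype ι] (v : ι → (Fin n → ℝ)) : Set (Fin n → ℝ) :=
  ∑ i, segment ℝ 0 (v i)

/-- The objective function `x ↦ c · x` is nondegenerate on `P`: no two vertices of `P` have the
same objective value. -/
def IsNondegenerate {n : ℕ} (P : Set (Fin n → ℝ)) (c : Fin n → ℝ) : Prop :=
  Set.InjOn (fun x => c ⬝ᵥ x) (vertices P)

/-- The arcs of the directed graph of `P` for the linear program `min c · x`, `x ∈ P`: every edge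
of `P` is oriented towards its endpoint of smaller objective value. -/
def improvingEdges {n : ℕ} (P : Set (Fin n → ℝ)) (c : Fin n → ℝ) :
    SetRel (Fin n → ℝ) (Fin n → ℝ) :=
  {a | IsEdge P a.1 a.2 ∧ c ⬝ᵥ a.2 < c ⬝ᵥ a.1}

/-- `x` is an optimal vertex of the linear program `min c · x`, `x ∈ P`. -/
def IsOptimalVertex {n : ℕ} (P : Set (Fin n → ℝ)) (c x : Fin n → ℝ) : Prop :=
  x ∈ vertices P ∧ ∀ y ∈ P, c ⬝ᵥ x ≤ c ⬝ᵥ y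

/-- A `c`-monotone path on `P`: a directed path along improving edges which starts at a vertex and
ends at the optimal vertex. Its length is the number `p.length` of its edges. -/
def IsMonotonePath {n : ℕ} (P : Set (Fin n → ℝ)) (c : Fin n → ℝ)
    (p : RelSeries (improvingEdges P c)) : Prop :=
  p.head ∈ vertices P ∧ IsOptimalVertex P c p.last

/-- The length of a shortest `c`-monotone path on `P` that starts at `x` (`⊤` if there is none). -/
noncomputable def monotoneDistance {n : ℕ} (P : Set (Fin n → ℝ)) (c x : Fin n → ℝ) : ℕ∞ :=
  ⨅ (p : RelSeries (improvingEdges P c)) (_ : IsMonotonePath P c p ∧ p.head = x), (p.length : ℕ∞)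

/-- The `c`-monotone diameter of `P`: the maximal length of a shortest `c`-monotone path, over all
starting vertices. -/
noncomputable def objectiveMonotoneDiameter {n : ℕ} (P : Set (Fin n → ℝ)) (c : Fin n → ℝ) : ℕ∞ :=
  ⨆ x ∈ vertices P, monotoneDistance P c x

/-- The monotone diameter of `P`: the maximal `c`-monotone diameter, over all nondegenerate
objective functions `c`. -/
noncomputable def monotoneDiameter {n : ℕ} (P : Set (Fin n → ℝ)) : ℕ∞ :=
  ⨆ (c : Fin n → ℝ) (_ : IsNondegenerate P c), objectiveMonotoneDiameter P c

/-! Two potentials, each changing in a controlled way along an edge, give all the bounds.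

On a zonotope, count at `x` the generators along which a full step that lowers `c` stays inside
(`decreasingGenerators`). The two ends of an edge maximize a common functional `l`, so generators
with `l (v i) ≠ 0` are in the same state at both ends, and only generators orthogonal to `l` can
change. An improving edge loses at least one of these (`ncard_decreasingGenerators_lt`), which
bounds every monotone path by the number of generators. If the generators are nonzero and pairwise
nonparallel, it loses at most one (`ncard_decreasingGenerators_le`). For `c` orthogonal to no
generator, the count falls from all generators at the maximum to none at the minimum, so that many
edges are needed.

On a general polytope, the shadow vertex rule builds a short path: start with `l` exposing `x` and
follow the maximizer of `l - t c` as `t` grows (`exists_pivot`). The direction of each pivot edge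
leaves the shrinking set `directionsAbove` for good, so no direction is used twice. Minimality of
`E` makes its members correspond bijectively to the edge directions. -/

section Zonotope

variable {n : ℕ} {ι : Type*} [Fintype ι] {v : ι → (Fin n → ℝ)}

/-! ### Zonotopes in terms of coefficients -/

theorem mem_zonotope_iff {x : Fin n → ℝ} :
    x ∈ zonotope v ↔ ∃ t : ι → ℝ, (∀ i, 0 ≤ t i ∧ t i ≤ 1) ∧ x = ∑ i, t i • v i := by
  unfold zonotope
  rw [Set.mem_fintype_sum]
  constructor
  · rintro ⟨g, hg, rfl⟩
    have : ∀ i, ∃ s : ℝ, (0 ≤ s ∧ s ≤ 1) ∧ g i = s • v i := by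
      intro i
      have h := hg i
      rw [segment_eq_image] at h
      obtain ⟨s, hs, h⟩ := h
      exact ⟨s, ⟨hs.1, hs.2⟩, by simpa using h.symm⟩
    choose t ht htg using this
    exact ⟨t, ht, Finset.sum_congr rfl fun i _ => htg i⟩
  · rintro ⟨t, ht, rfl⟩
    refine ⟨fun i => t i • v i, fun i => ?_, rfl⟩
    rw [segment_eq_image]
    exact ⟨t i, ⟨(ht i).1, (ht i).2⟩, by simp⟩

theorem add_smul_mem_zonotope {t : ι → ℝ} (ht : ∀ i, 0 ≤ t i ∧ t i ≤ 1) (i : ι) {s : ℝ}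
    (hs : 0 ≤ t i + s) (hs' : t i + s ≤ 1) : ∑ j, t j • v j + s • v i ∈ zonotope v := by
  classical
  refine mem_zonotope_iff.2 ⟨t + Pi.single i s, fun j => ?_, ?_⟩
  · by_cases h : j = i
    · subst h; simpa using ⟨hs, hs'⟩
    · simpa [h] using ht j
  · simp [add_smul, Finset.sum_add_distrib, Pi.single_apply, ite_smul]

theorem isPolytope_zonotope (v : ι → (Fin n → ℝ)) : IsPolytope (zonotope v) := by
  refine ⟨∑ i, ({0, v i} : Set (Fin n → ℝ)), ?_, ?_⟩
  · exact Finset.sum_induction _ Set.Finite (fun _ _ => Set.Finite.add) Set.finite_zero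
      fun i _ => Set.toFinite _
  · simp [zonotope, convexHull_sum, convexHull_pair]

/-- The functional `l` attains its maximum over `P` at `x`. -/
def IsMaximizer (P : Set (Fin n → ℝ)) (l : StrongDual ℝ (Fin n → ℝ)) (x : Fin n → ℝ) : Prop :=
  x ∈ P ∧ ∀ y ∈ P, l y ≤ l x

/-- Otherwise raising the coefficient to `1` would increase `l`. -/
theorem IsMaximizer.coeff_eq_one {l : StrongDual ℝ (Fin n → ℝ)} {t : ι → ℝ}
    (ht : ∀ i, 0 ≤ t i ∧ t i ≤ 1) (h : IsMaximizer (zonotope v) l (∑ j, t j • v j)) {i : ι}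
    (hi : 0 < l (v i)) : t i = 1 := by
  have h1 := h.2 _ (add_smul_mem_zonotope (v := v) ht i (s := 1 - t i) (by linarith) (by linarith))
  rw [map_add, map_smul, smul_eq_mul] at h1
  nlinarith [(ht i).2]

theorem IsMaximizer.coeff_eq_zero {l : StrongDual ℝ (Fin n → ℝ)} {t : ι → ℝ}
    (ht : ∀ i, 0 ≤ t i ∧ t i ≤ 1) (h : IsMaximizer (zonotope v) l (∑ j, t j • v j)) {i : ι}
    (hi : l (v i) < 0) : t i = 0 := by
  have h1 := h.2 _ (add_smul_mem_zonotope (v := v) ht i (s := - t i) (by linarith)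
    (by linarith))
  rw [map_add, map_smul, smul_eq_mul] at h1
  nlinarith [(ht i).1]

/-- Moving from a maximizer of `l` along a generator against `l` stays in the zonotope. -/
theorem IsMaximizer.sub_smul_mem {l : StrongDual ℝ (Fin n → ℝ)} {x : Fin n → ℝ}
    (h : IsMaximizer (zonotope v) l x) {i : ι} {s : ℝ} (hs : s = 1 ∨ s = -1)
    (hi : 0 < s * l (v i)) : x - s • v i ∈ zonotope v := by
  obtain ⟨t, ht, rfl⟩ := mem_zonotope_iff.1 h.1
  rw [sub_eq_add_neg, ← neg_smul]
  rcases hs with rfl | rfl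
  · have := h.coeff_eq_one ht (i := i) (by linarith)
    exact add_smul_mem_zonotope ht i (by linarith) (by linarith)
  · have := h.coeff_eq_zero ht (i := i) (by linarith)
    exact add_smul_mem_zonotope ht i (by linarith) (by linarith)

/-- The generators along which one can move from `x` inside the zonotope by a full step that
decreases the objective function `c`. -/
def decreasingGenerators (v : ι → (Fin n → ℝ)) (c x : Fin n → ℝ) : Set ι :=
  {i | ∃ s : ℝ, (s = 1 ∨ s = -1) ∧ 0 < s * (c ⬝ᵥ v i) ∧ x - s • v i ∈ zonotope v}

theorem le_of_mem_segment {c x y z : Fin n → ℝ} (hc : c ⬝ᵥ y ≤ c ⬝ᵥ x)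
    (hz : z ∈ segment ℝ x y) : c ⬝ᵥ y ≤ c ⬝ᵥ z := by
  obtain ⟨a, b, ha, hb, hab, rfl⟩ := hz
  simp only [dotProduct_add, dotProduct_smul, smul_eq_mul]
  obtain rfl : b = 1 - a := by linarith
  nlinarith

theorem exists_functional_of_isEdge {P : Set (Fin n → ℝ)} {x y : Fin n → ℝ} (h : IsEdge P x y) :
    ∃ l : StrongDual ℝ (Fin n → ℝ), ∀ z, z ∈ segment ℝ x y ↔ IsMaximizer P l z := by
  obtain ⟨l, hl⟩ := h.2.2.2 ⟨x, left_mem_segment ℝ x y⟩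
  exact ⟨l, fun z => by rw [hl]; rfl⟩

/-! ### Change of the potential along an edge of a zonotope -/

section Step

variable {c x y : Fin n → ℝ} {l : StrongDual ℝ (Fin n → ℝ)}

/-- A step orthogonal to `l` would stay on the edge, where `c` cannot go below its value at `y`. -/
theorem functional_ne_zero_of_mem_decreasingGenerators (hc : c ⬝ᵥ y < c ⬝ᵥ x)
    (hl : ∀ z, z ∈ segment ℝ x y ↔ IsMaximizer (zonotope v) l z) {i : ι}
    (hi : i ∈ decreasingGenerators v c y) : l (v i) ≠ 0 := by
  intro h0
  obtain ⟨s, -, hs, hmem⟩ := hi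
  have hy := (hl y).1 (right_mem_segment ℝ x y)
  have : y - s • v i ∈ segment ℝ x y := (hl _).2 ⟨hmem, fun z hz => by
    simpa [h0] using hy.2 z hz⟩
  have := le_of_mem_segment hc.le this
  simp only [dotProduct_sub, dotProduct_smul, smul_eq_mul] at this
  linarith

/-- Feasibility of the step at the maximizer `y` forces `s * l (v i) > 0`, and this sign alone makes
the same step feasible at any other maximizer of `l`. -/
theorem mem_decreasingGenerators_of_isMaximizer {i : ι}
    (hx : IsMaximizer (zonotope v) l x) (hy : IsMaximizer (zonotope v) l y) (h0 : l (v i) ≠ 0)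
    (hi : i ∈ decreasingGenerators v c y) : i ∈ decreasingGenerators v c x := by
  obtain ⟨s, hs, hsc, hmem⟩ := hi
  refine ⟨s, hs, hsc, hx.sub_smul_mem hs ?_⟩
  have h1 := hy.2 _ hmem
  rw [map_sub, map_smul, smul_eq_mul] at h1
  have : s ≠ 0 := by rcases hs with rfl | rfl <;> norm_num
  exact lt_of_le_of_ne (by linarith) (mul_ne_zero this h0).symm

/-- The coefficients of `x` and `y` agree wherever `l (v i) ≠ 0`, so the drop in `c` must come from
a generator orthogonal to `l`. Since `x` is a vertex, its coefficient there is `0` or `1`, which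
makes the step a full one. -/
theorem exists_mem_decreasingGenerators_functional_eq_zero (hx : x ∈ vertices (zonotope v))
    (hc : c ⬝ᵥ y < c ⬝ᵥ x) (hlx : IsMaximizer (zonotope v) l x)
    (hly : IsMaximizer (zonotope v) l y) :
    ∃ i ∈ decreasingGenerators v c x, l (v i) = 0 := by
  obtain ⟨t, ht, rfl⟩ := mem_zonotope_iff.1 hlx.1
  obtain ⟨t', ht', rfl⟩ := mem_zonotope_iff.1 hly.1
  have hsum : 0 < ∑ i, (t i - t' i) * (c ⬝ᵥ v i) := by
    simp only [sub_mul, Finset.sum_sub_distrib]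
    simp only [dotProduct_sum, dotProduct_smul, smul_eq_mul] at hc
    linarith
  obtain ⟨i, -, hi⟩ := Finset.exists_lt_of_sum_lt (s := Finset.univ) (f := fun _ => (0 : ℝ))
    (by simpa using hsum)
  have hl0 : l (v i) = 0 := by
    rcases lt_trichotomy (l (v i)) 0 with h | h | h
    · rw [hlx.coeff_eq_zero ht h, hly.coeff_eq_zero ht' h] at hi; simp at hi
    · exact h
    · rw [hlx.coeff_eq_one ht h, hly.coeff_eq_one ht' h] at hi; simp at hi
  obtain ⟨hxP, g, hg⟩ := hx
  have hmax : IsMaximizer (zonotope v) g (∑ j, t j • v j) := ⟨hxP, fun y hy => (hg y hy).1⟩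
  have hv : v i ≠ 0 := by intro h; simp [h] at hi
  refine ⟨i, ?_, hl0⟩
  rcases lt_trichotomy (g (v i)) 0 with h | h | h
  · have h0 := hmax.coeff_eq_zero ht h
    refine ⟨-1, Or.inr rfl, ?_, hmax.sub_smul_mem (Or.inr rfl) (by linarith)⟩
    rw [h0] at hi
    nlinarith [(ht' i).1]
  -- Here moving along `v i` keeps `g` maximal, so uniqueness of the maximizer rules out any move;
  -- but a coefficient in `[0, 1]` can always move.
  · exfalso
    have key : ∀ s : ℝ, 0 ≤ t i + s → t i + s ≤ 1 → s = 0 := by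
      intro s h1 h2
      have := (hg _ (add_smul_mem_zonotope (v := v) ht i h1 h2)).2 (by simp [h])
      simpa [hv] using this
    have h1 := key (- t i) (by linarith) (by linarith)
    have h2 := key (1 - t i) (by linarith) (by linarith)
    linarith
  · have h0 := hmax.coeff_eq_one ht h
    refine ⟨1, Or.inl rfl, ?_, hmax.sub_smul_mem (Or.inl rfl) (by linarith)⟩
    rw [h0] at hi
    nlinarith [(ht' i).2]

theorem ncard_decreasingGenerators_lt (he : IsEdge (zonotope v) x y) (hc : c ⬝ᵥ y < c ⬝ᵥ x) :
    (decreasingGenerators v c y).ncard + 1 ≤ (decreasingGenerators v c x).ncard := by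
  obtain ⟨l, hl⟩ := exists_functional_of_isEdge he
  have hlx := (hl x).1 (left_mem_segment ℝ x y)
  have hly := (hl y).1 (right_mem_segment ℝ x y)
  obtain ⟨i, hi, hi0⟩ := exists_mem_decreasingGenerators_functional_eq_zero he.1 hc hlx hly
  refine Set.ncard_lt_ncard ⟨fun j hj => ?_, fun hsub => ?_⟩ (Set.toFinite _)
  · exact mem_decreasingGenerators_of_isMaximizer hlx hly
      (functional_ne_zero_of_mem_decreasingGenerators hc hl hj) hj
  · exact functional_ne_zero_of_mem_decreasingGenerators hc hl (hsub hi) hi0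

theorem mem_span_sub_of_mem_decreasingGenerators
    (hl : ∀ z, z ∈ segment ℝ x y ↔ IsMaximizer (zonotope v) l z) {i : ι}
    (hi : i ∈ decreasingGenerators v c x) (h0 : l (v i) = 0) :
    v i ∈ Submodule.span ℝ {y - x} := by
  obtain ⟨s, hs, -, hmem⟩ := hi
  have hx := (hl x).1 (left_mem_segment ℝ x y)
  have : x - s • v i ∈ segment ℝ x y := (hl _).2 ⟨hmem, fun z hz => by
    simpa [h0] using hx.2 z hz⟩
  rw [segment_eq_image'] at this
  obtain ⟨θ, -, hθ⟩ := this
  have hsv : s • v i = (-θ) • (y - x) := by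
    rw [neg_smul, eq_neg_iff_add_eq_zero]
    have hθ' : θ • (y - x) = -(s • v i) := by
      have := congrArg (fun z => z - x) hθ
      simpa using this
    rw [hθ']; simp
  rw [Submodule.mem_span_singleton]
  refine ⟨s * -θ, ?_⟩
  rw [mul_smul, ← hsv, smul_smul]
  rcases hs with rfl | rfl <;> simp

/-- A generator lost on the way to `y` is orthogonal to `l`, hence parallel to the edge, and at most
one generator has that direction. -/
theorem ncard_decreasingGenerators_le (hv : ∀ i, v i ≠ 0)
    (hpar : Function.Injective fun i => Submodule.span ℝ {v i})
    (he : IsEdge (zonotope v) x y) :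
    (decreasingGenerators v c x).ncard ≤ (decreasingGenerators v c y).ncard + 1 := by
  obtain ⟨l, hl⟩ := exists_functional_of_isEdge he
  have hlx := (hl x).1 (left_mem_segment ℝ x y)
  have hly := (hl y).1 (right_mem_segment ℝ x y)
  have hspan : ∀ i ∈ decreasingGenerators v c x, l (v i) = 0 →
      Submodule.span ℝ {v i} = Submodule.span ℝ {y - x} := by
    intro i hi h0
    obtain ⟨a, ha⟩ := Submodule.mem_span_singleton.1
      (mem_span_sub_of_mem_decreasingGenerators hl hi h0)
    have ha0 : a ≠ 0 := by rintro rfl; exact hv i (by simpa using ha.symm)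
    rw [← ha, Submodule.span_singleton_smul_eq (IsUnit.mk0 a ha0)]
  have hsub : {i ∈ decreasingGenerators v c x | l (v i) = 0}.Subsingleton :=
    fun i hi j hj => hpar ((hspan i hi.1 hi.2).trans (hspan j hj.1 hj.2).symm)
  have hcover : decreasingGenerators v c x ⊆
      decreasingGenerators v c y ∪ {i ∈ decreasingGenerators v c x | l (v i) = 0} := by
    intro i hi
    by_cases h0 : l (v i) = 0
    · exact Or.inr ⟨hi, h0⟩
    · exact Or.inl (mem_decreasingGenerators_of_isMaximizer hly hlx h0 hi)
  calc _ ≤ _ := Set.ncard_le_ncard hcover (Set.toFinite _)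
    _ ≤ _ := Set.ncard_union_le _ _
    _ ≤ _ := by
      gcongr
      exact Set.ncard_le_one_iff_subsingleton.2 hsub

end Step

theorem RelSeries.potential_last_add_length_le {α : Type*} {r : SetRel α α} {N : α → ℕ}
    (hN : ∀ a b, (a, b) ∈ r → N b + 1 ≤ N a) (p : RelSeries r) :
    N p.last + p.length ≤ N p.head := by
  induction p using RelSeries.inductionOn with
  | singleton x => simp
  | cons p x hx ih =>
    have := hN _ _ hx
    simp only [RelSeries.last_cons, RelSeries.head_cons, RelSeries.cons_length]
    omega

theorem RelSeries.potential_head_le {α : Type*} {r : SetRel α α} {N : α → ℕ}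
    (hN : ∀ a b, (a, b) ∈ r → N a ≤ N b + 1) (p : RelSeries r) :
    N p.head ≤ N p.last + p.length := by
  induction p using RelSeries.inductionOn with
  | singleton x => simp
  | cons p x hx ih =>
    have := hN _ _ hx
    simp only [RelSeries.last_cons, RelSeries.head_cons, RelSeries.cons_length]
    omega

/-- Improving paths on a zonotope have at most as many edges as there are generators. -/
theorem length_le_card_of_zonotope {c : Fin n → ℝ}
    (p : RelSeries (improvingEdges (zonotope v) c)) : p.length ≤ Fintype.card ι := by
  have h := RelSeries.potential_last_add_length_le
    (N := fun x => (decreasingGenerators v c x).ncard)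
    (fun a b hab => ncard_decreasingGenerators_lt hab.1 hab.2) p
  have h2 : (decreasingGenerators v c p.head).ncard ≤ Fintype.card ι := by
    simpa [Set.ncard_univ] using
      Set.ncard_le_ncard (Set.subset_univ (decreasingGenerators v c p.head))
  omega

/-- If no generator is orthogonal to `c`, then monotone paths from the vertex maximizing `c`
traverse all generators. -/
theorem card_le_length_of_zonotope {c x : Fin n → ℝ} (hv : ∀ i, v i ≠ 0)
    (hpar : Function.Injective fun i => Submodule.span ℝ {v i})
    (hc : ∀ i, c ⬝ᵥ v i ≠ 0) (hx : x ∈ zonotope v) (hmax : ∀ y ∈ zonotope v, c ⬝ᵥ y ≤ c ⬝ᵥ x)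
    (p : RelSeries (improvingEdges (zonotope v) c)) (hp : IsMonotonePath (zonotope v) c p)
    (hhead : p.head = x) : Fintype.card ι ≤ p.length := by
  have h := RelSeries.potential_head_le (N := fun x => (decreasingGenerators v c x).ncard)
    (fun a b hab => ncard_decreasingGenerators_le hv hpar hab.1) p
  have hlast : decreasingGenerators v c p.last = ∅ := by
    refine Set.eq_empty_of_forall_notMem ?_
    rintro i ⟨s, -, hs, hmem⟩
    have := hp.2.2 _ hmem
    simp only [dotProduct_sub, dotProduct_smul, smul_eq_mul] at this
    linarith
  have hfull : decreasingGenerators v c p.head = Set.univ := by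
    have hm : IsMaximizer (zonotope v) (dotProductBilin ℝ ℝ c).toContinuousLinearMap x :=
      ⟨hx, hmax⟩
    refine Set.eq_univ_of_forall fun i => ?_
    rw [hhead]
    rcases lt_or_gt_of_ne (hc i) with h | h
    · have h' : 0 < -1 * (c ⬝ᵥ v i) := by linarith
      exact ⟨-1, Or.inr rfl, h', hm.sub_smul_mem (Or.inr rfl) h'⟩
    · have h' : 0 < 1 * (c ⬝ᵥ v i) := by linarith
      exact ⟨1, Or.inl rfl, h', hm.sub_smul_mem (Or.inl rfl) h'⟩
  rw [hlast, hfull, Set.ncard_empty, Set.ncard_univ, Nat.card_eq_fintype_card] at h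
  omega

end Zonotope

/-! ### Short monotone paths by the shadow vertex rule -/

section MonotonePath

open Filter Topology

variable {n : ℕ} {S : Set (Fin n → ℝ)}

theorem vertices_convexHull_subset : vertices (convexHull ℝ S) ⊆ S :=
  fun _ hx => extremePoints_convexHull_subset (exposedPoints_subset_extremePoints hx)

theorem le_of_mem_convexHull {l : StrongDual ℝ (Fin n → ℝ)} {M : ℝ} (h : ∀ z ∈ S, l z ≤ M)
    {p : Fin n → ℝ} (hp : p ∈ convexHull ℝ S) : l p ≤ M :=
  convexHull_min (t := {z | l z ≤ M}) h
    (convex_halfSpace_le l.toLinearMap.isLinear M) hp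

/-- The face of a convex hull cut out by a supporting hyperplane is contained in every convex set
that contains the generating points on this hyperplane. -/
theorem mem_of_mem_convexHull_of_eq {l : StrongDual ℝ (Fin n → ℝ)} {M : ℝ} {C : Set (Fin n → ℝ)}
    (hC : Convex ℝ C) (hCM : ∀ z ∈ C, l z = M) (h : ∀ z ∈ S, l z < M ∨ z ∈ C)
    {p : Fin n → ℝ} (hp : p ∈ convexHull ℝ S) (hpM : l p = M) : p ∈ C := by
  -- A proper convex combination involving a point strictly below the level `M` is itself strictly
  -- below `M`.
  have hconv : Convex ℝ ({z | l z < M} ∪ C) := by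
    intro x hx y hy a b ha hb hab
    rcases ha.eq_or_lt with rfl | ha
    · obtain rfl : b = 1 := by linarith
      simpa using hy
    rcases hb.eq_or_lt with rfl | hb
    · obtain rfl : a = 1 := by linarith
      simpa using hx
    have hle : ∀ z ∈ {z | l z < M} ∪ C, l z ≤ M := fun z hz =>
      hz.elim (fun h => le_of_lt h) fun h => (hCM z h).le
    obtain rfl : b = 1 - a := by linarith
    by_cases hxC : x ∈ C
    · by_cases hyC : y ∈ C
      · exact Or.inr (hC hxC hyC ha.le hb.le hab)
      · have hy' : l y < M := hy.resolve_right hyC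
        left
        simp only [Set.mem_ofPred_eq, map_add, map_smul, smul_eq_mul]
        nlinarith [hle x hx]
    · have hx' : l x < M := hx.resolve_right hxC
      left
      simp only [Set.mem_ofPred_eq, map_add, map_smul, smul_eq_mul]
      nlinarith [hle y hy]
  exact (convexHull_min (t := {z | l z < M} ∪ C) h hconv hp).resolve_left
    fun hlt => absurd hpM (ne_of_lt hlt)

/-- The functional `l` attains its maximum over `S` at `x` and nowhere else. -/
def IsStrictMaximizer (S : Set (Fin n → ℝ)) (l : StrongDual ℝ (Fin n → ℝ)) (x : Fin n → ℝ) :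
    Prop :=
  x ∈ S ∧ ∀ y ∈ S, y ≠ x → l y < l x

theorem IsStrictMaximizer.mem_vertices {l : StrongDual ℝ (Fin n → ℝ)} {x : Fin n → ℝ}
    (h : IsStrictMaximizer S l x) : x ∈ vertices (convexHull ℝ S) := by
  have hle : ∀ y ∈ convexHull ℝ S, l y ≤ l x := fun y hy =>
    le_of_mem_convexHull (fun z hz => by
      by_cases hzx : z = x
      · rw [hzx]
      · exact (h.2 z hz hzx).le) hy
  refine ⟨subset_convexHull ℝ S h.1, l, fun y hy => ⟨hle y hy, fun hxy => ?_⟩⟩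
  refine mem_of_mem_convexHull_of_eq (convex_singleton x) (M := l x) (by simp) (fun z hz => ?_) hy
    (le_antisymm (hle y hy) hxy)
  by_cases hzx : z = x
  · exact Or.inr hzx
  · exact Or.inl (h.2 z hz hzx)

theorem exists_isStrictMaximizer {x : Fin n → ℝ} (hx : x ∈ vertices (convexHull ℝ S)) :
    ∃ l, IsStrictMaximizer S l x := by
  refine ⟨hx.2.choose, vertices_convexHull_subset hx, fun y hy hyx => ?_⟩
  have := hx.2.choose_spec y (subset_convexHull ℝ S hy)
  exact lt_of_not_ge fun h => hyx (this.2 h)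

theorem exists_dual_ne_zero_on (W : Set (Fin n → ℝ)) (hW : W.Finite) :
    ∃ g : StrongDual ℝ (Fin n → ℝ), ∀ w ∈ W, w ≠ 0 → g w ≠ 0 := by
  have := hW.to_subtype
  obtain ⟨g, hg⟩ := Module.exists_dual_forall_apply_ne_zero (K := ℝ)
    (fun w : {w : W // (w : Fin n → ℝ) ≠ 0} => (w : Fin n → ℝ)) fun w => w.2
  exact ⟨g.toContinuousLinearMap, fun w hw h0 => hg ⟨⟨w, hw⟩, h0⟩⟩

theorem eventually_add_mul_lt {a b M N : ℝ} (h : a < M) :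
    ∀ᶠ ε : ℝ in 𝓝[>] 0, a + ε * b < M + ε * N := by
  have h1 : Tendsto (fun ε : ℝ => a + ε * b) (𝓝[>] 0) (𝓝 (a + 0 * b)) :=
    (Continuous.tendsto (by fun_prop) 0).mono_left nhdsWithin_le_nhds
  have h2 : Tendsto (fun ε : ℝ => M + ε * N) (𝓝[>] 0) (𝓝 (M + 0 * N)) :=
    (Continuous.tendsto (by fun_prop) 0).mono_left nhdsWithin_le_nhds
  exact h1.eventually_lt h2 (by simpa using h)

theorem eventually_add_mul_ne_zero {a b : ℝ} (h : b ≠ 0) :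
    ∀ᶠ ε : ℝ in 𝓝[>] 0, a + ε * b ≠ 0 := by
  by_cases ha : a = 0
  · filter_upwards [self_mem_nhdsWithin] with ε hε
    simpa [ha, h] using (ne_of_gt (Set.mem_Ioi.1 hε))
  · have h1 : Tendsto (fun ε : ℝ => a + ε * b) (𝓝[>] 0) (𝓝 (a + 0 * b)) :=
      (Continuous.tendsto (by fun_prop) 0).mono_left nhdsWithin_le_nhds
    exact h1.eventually_ne (by simpa using ha)

/-- A vertex is the unique maximizer of a functional that avoids a given finite set of nonzero
vectors. -/
theorem exists_isStrictMaximizer_generic (hS : S.Finite) {x : Fin n → ℝ}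
    (hx : x ∈ vertices (convexHull ℝ S)) (W : Set (Fin n → ℝ)) (hW : W.Finite) :
    ∃ l, IsStrictMaximizer S l x ∧ ∀ w ∈ W, w ≠ 0 → l w ≠ 0 := by
  obtain ⟨l, hl⟩ := exists_isStrictMaximizer hx
  obtain ⟨g, hg⟩ := exists_dual_ne_zero_on W hW
  -- A small perturbation `l + ε g` keeps the finitely many strict inequalities and moves off the
  -- finitely many zeros.
  have h1 : ∀ᶠ ε : ℝ in 𝓝[>] 0, ∀ y ∈ S, y ≠ x → l y + ε * g y < l x + ε * g x := by
    rw [hS.eventually_all]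
    intro y hy
    by_cases hyx : y = x
    · simp [hyx]
    · filter_upwards [eventually_add_mul_lt (b := g y) (N := g x) (hl.2 y hy hyx)] with ε hε _
      exact hε
  have h2 : ∀ᶠ ε : ℝ in 𝓝[>] 0, ∀ w ∈ W, w ≠ 0 → l w + ε * g w ≠ 0 := by
    rw [hW.eventually_all]
    intro w hw
    by_cases h0 : w = 0
    · simp [h0]
    · filter_upwards [eventually_add_mul_ne_zero (a := l w) (hg w hw h0)] with ε hε _
      exact hε
  obtain ⟨ε, h1, h2⟩ := (h1.and h2).exists
  exact ⟨l + ε • g, ⟨hl.1, h1⟩, h2⟩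

theorem finite_edgeDirections (hS : S.Finite) : (edgeDirections (convexHull ℝ S)).Finite := by
  refine ((hS.prod hS).image fun a => Submodule.span ℝ {a.2 - a.1}).subset ?_
  rintro _ ⟨u, v, h, rfl⟩
  exact ⟨(u, v), ⟨vertices_convexHull_subset h.1, vertices_convexHull_subset h.2.1⟩, rfl⟩

/-- The edge directions along which `l - t c` decreases whenever `c` decreases. -/
def directionsAbove (P : Set (Fin n → ℝ)) (l c : StrongDual ℝ (Fin n → ℝ)) (t : ℝ) :
    Set (Submodule ℝ (Fin n → ℝ)) :=
  {L ∈ edgeDirections P | ∃ d ∈ L, 0 < c d ∧ t * c d < l d}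

/-- One pivot of the shadow vertex rule: rotating the functional `l - t c` towards `-c` leads from
the vertex `x` to a vertex `y` along an improving edge. -/
theorem exists_pivot (hS : S.Finite) {l c : StrongDual ℝ (Fin n → ℝ)} {t : ℝ} {x : Fin n → ℝ}
    (hx : IsStrictMaximizer S (l - t • c) x)
    (hgen : ∀ z ∈ S, ∀ z' ∈ S, (c x - c z') • (x - z) - (c x - c z) • (x - z') ≠ 0 →
      l ((c x - c z') • (x - z) - (c x - c z) • (x - z')) ≠ 0)
    (hopt : ∃ z ∈ S, c z < c x) :
    ∃ y t', t < t' ∧ IsStrictMaximizer S (l - t' • c) y ∧ c y < c x ∧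
      IsEdge (convexHull ℝ S) x y ∧
      Submodule.span ℝ {y - x} ∈ directionsAbove (convexHull ℝ S) l c t ∧
      Submodule.span ℝ {y - x} ∉ directionsAbove (convexHull ℝ S) l c t' := by
  -- Ratio test: `τ` is the first parameter at which a point with smaller `c` ties with `x` for `l -
  -- τ c`.
  obtain ⟨z₀, ⟨hz₀S, hz₀c⟩, hmin⟩ := Set.exists_min_image {z ∈ S | c z < c x}
    (fun z => (l x - l z) / (c x - c z)) (hS.subset (Set.sep_subset _ _)) hopt
  set τ := (l x - l z₀) / (c x - c z₀) with hτ
  have hτz₀ : l x - l z₀ = τ * (c x - c z₀) := by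
    rw [hτ, div_mul_cancel₀]; linarith
  have hstrict : ∀ z ∈ S, z ≠ x → l z - t * c z < l x - t * c x := hx.2
  have htτ : t < τ := by
    rw [hτ, lt_div_iff₀ (by linarith)]
    have := hstrict z₀ hz₀S (by rintro rfl; exact lt_irrefl _ hz₀c)
    linarith
  have hle : ∀ z ∈ S, c z < c x → τ * (c x - c z) ≤ l x - l z := fun z hz hzc => by
    have := hmin z ⟨hz, hzc⟩
    rwa [le_div_iff₀ (by linarith)] at this
  have hlt : ∀ z ∈ S, z ≠ x → c x ≤ c z → τ * (c x - c z) < l x - l z := fun z hz hzx hzc => by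
    have := hstrict z hz hzx
    nlinarith
  -- Among the tied points, the lowest one for `c` is the far end of the new face.
  obtain ⟨y, ⟨hyS, hyc, hyτ⟩, hymin⟩ := Set.exists_min_image
    {z ∈ S | c z < c x ∧ l x - l z = τ * (c x - c z)} c (hS.subset (Set.sep_subset _ _))
    ⟨z₀, hz₀S, hz₀c, hτz₀⟩
  have hyx : y ≠ x := by rintro rfl; exact lt_irrefl _ hyc
  -- A tie makes `l` vanish on the combination in `hgen`, so by genericity the combination is zero.
  -- Hence all tied points are collinear with `x` and `y`, and the face is a segment.
  have htie : ∀ z ∈ S, c z < c x → l x - l z = τ * (c x - c z) →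
      (c x - c y) • (x - z) = (c x - c z) • (x - y) := by
    intro z hz hzc hzτ
    by_contra hne
    refine hgen z hz y hyS (sub_ne_zero.2 hne) ?_
    simp only [map_sub, map_smul, smul_eq_mul]
    rw [hzτ, hyτ]
    ring
  have hseg : ∀ z ∈ S, l z - τ * c z < l x - τ * c x ∨ z ∈ segment ℝ x y := by
    intro z hz
    by_cases hzx : z = x
    · exact Or.inr (hzx ▸ left_mem_segment ℝ z y)
    rcases le_or_gt (c x) (c z) with hzc | hzc
    · left
      have := hlt z hz hzx hzc
      linarith
    rcases (hle z hz hzc).lt_or_eq with h | h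
    · left; linarith
    right
    have hyz := hymin z ⟨hz, hzc, h.symm⟩
    rw [segment_eq_image']
    refine ⟨(c x - c z) / (c x - c y), ⟨div_nonneg (by linarith) (by linarith),
      (div_le_one (by linarith)).2 (by linarith)⟩, ?_⟩
    have h3 := htie z hz hzc h.symm
    have hpos : c x - c y ≠ 0 := by linarith
    have h4 : x - z = ((c x - c z) / (c x - c y)) • (x - y) := by
      rw [div_eq_inv_mul, mul_smul, ← h3, smul_smul, inv_mul_cancel₀ hpos, one_smul]
    have h5 : ((c x - c z) / (c x - c y)) • (y - x) = z - x := by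
      rw [← neg_sub x y, smul_neg, ← h4, neg_sub]
    simp only [h5, add_sub_cancel]
  have hsegM : ∀ z ∈ segment ℝ x y, (l - τ • c) z = l x - τ * c x := by
    rintro z ⟨a, b, -, -, hab, rfl⟩
    obtain rfl : b = 1 - a := by linarith
    simp only [sub_apply, smul_apply, map_add, map_smul,
      smul_eq_mul]
    linear_combination (-(1 - a)) * hyτ
  have hPle : ∀ p ∈ convexHull ℝ S, (l - τ • c) p ≤ l x - τ * c x := fun p hp =>
    le_of_mem_convexHull (fun z hz => (hseg z hz).elim le_of_lt fun h => (hsegM z h).le) hp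
  -- Rotating slightly past `τ` breaks the tie on the segment in favor of its `c`-lowest end `y`.
  have hev : ∀ᶠ ε : ℝ in 𝓝[>] 0, ∀ z ∈ S, z ≠ y →
      (l - τ • c) z + ε * (-c z) < (l - τ • c) y + ε * (-c y) := by
    rw [hS.eventually_all]
    intro z hz
    rcases hseg z hz with h | h
    · have h' : (l - τ • c) z < (l - τ • c) y := by
        rw [hsegM y (right_mem_segment ℝ x y)]; exact h
      filter_upwards [eventually_add_mul_lt (b := -c z) (N := -c y) h'] with ε hε _
      exact hε
    · filter_upwards [self_mem_nhdsWithin] with ε hε hzy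
      rw [hsegM z h, hsegM y (right_mem_segment ℝ x y)]
      have hcz : c y < c z := by
        rw [segment_eq_image'] at h
        obtain ⟨θ, hθ, rfl⟩ := h
        have hθ1 : θ < 1 := lt_of_le_of_ne hθ.2 (by rintro rfl; simp at hzy)
        simp only [map_add, map_smul, map_sub, smul_eq_mul]
        nlinarith
      have hε' : 0 < ε := hε
      nlinarith
  obtain ⟨ε, hε, hε0⟩ := (hev.and self_mem_nhdsWithin).exists
  have hε0 : 0 < ε := hε0
  have hyM : IsStrictMaximizer S (l - (τ + ε) • c) y := by
    refine ⟨hyS, fun z hz hzy => ?_⟩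
    have := hε z hz hzy
    simp only [sub_apply, smul_apply, smul_eq_mul] at this ⊢
    linarith
  have hxP := subset_convexHull ℝ S hx.1
  have hyP := subset_convexHull ℝ S hyS
  have hedge : IsEdge (convexHull ℝ S) x y := by
    refine ⟨hx.mem_vertices, hyM.mem_vertices, hyx.symm, fun _ => ⟨l - τ • c, ?_⟩⟩
    ext p
    constructor
    · intro hp
      refine ⟨(convex_convexHull ℝ S).segment_subset hxP hyP hp, fun q hq => ?_⟩
      rw [hsegM p hp]
      exact hPle q hq
    · rintro ⟨hp, hmax⟩
      exact mem_of_mem_convexHull_of_eq (convex_segment x y) hsegM hseg hp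
        (le_antisymm (hPle p hp) (hmax x hxP))
  refine ⟨y, τ + ε, by linarith, hyM, hyc, hedge, ⟨⟨x, y, hedge, rfl⟩, x - y, ?_, ?_, ?_⟩, ?_⟩
  · rw [← neg_sub y x]
    exact Submodule.neg_mem _ (Submodule.mem_span_singleton_self _)
  · rw [map_sub]; linarith
  · rw [map_sub, map_sub]; nlinarith
  -- On the line of the edge `l = τ c`, so `l d` cannot exceed `(τ + ε) * c d` when `c d > 0`.
  · rintro ⟨-, d, hd, hcd, hld⟩
    obtain ⟨a, rfl⟩ := Submodule.mem_span_singleton.1 hd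
    simp only [map_smul, map_sub, smul_eq_mul] at hcd hld
    have : a * (l y - l x) = τ * (a * (c y - c x)) := by linear_combination (-a) * hyτ
    nlinarith

/-- Induction on a bound `k` for the directions still available. The functional `l` stays fixed
while the current vertex moves, so genericity is required at every base point of `S`. -/
theorem exists_improving_path_aux (hS : S.Finite) {c : Fin n → ℝ} {l : StrongDual ℝ (Fin n → ℝ)}
    (hgen : ∀ x ∈ S, ∀ z ∈ S, ∀ z' ∈ S,
      (c ⬝ᵥ x - c ⬝ᵥ z') • (x - z) - (c ⬝ᵥ x - c ⬝ᵥ z) • (x - z') ≠ 0 →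
      l ((c ⬝ᵥ x - c ⬝ᵥ z') • (x - z) - (c ⬝ᵥ x - c ⬝ᵥ z) • (x - z')) ≠ 0) (k : ℕ) :
    ∀ (t : ℝ) (x : Fin n → ℝ),
      IsStrictMaximizer S (l - t • (dotProductBilin ℝ ℝ c).toContinuousLinearMap) x →
      (directionsAbove (convexHull ℝ S) l (dotProductBilin ℝ ℝ c).toContinuousLinearMap t).ncard
        ≤ k →
      ∃ p : RelSeries (improvingEdges (convexHull ℝ S) c),
        IsMonotonePath (convexHull ℝ S) c p ∧ p.head = x ∧ p.length ≤ k := by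
  set C : StrongDual ℝ (Fin n → ℝ) := (dotProductBilin ℝ ℝ c).toContinuousLinearMap with hC
  have hfin : ∀ t, (directionsAbove (convexHull ℝ S) l C t).Finite := fun t =>
    (finite_edgeDirections hS).subset (Set.sep_subset _ _)
  induction k with
  | zero =>
    intro t x hx hk
    by_cases hopt : ∃ z ∈ S, C z < C x
    -- A further pivot would need an available direction, and none is left.
    · obtain ⟨y, t', -, -, -, -, hmem, -⟩ := exists_pivot hS hx (hgen x hx.1) hopt
      rw [Nat.le_zero, Set.ncard_eq_zero (hfin t)] at hk
      exact absurd hmem (hk ▸ Set.notMem_empty _)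
    · push Not at hopt
      refine ⟨RelSeries.singleton _ x, ⟨hx.mem_vertices, hx.mem_vertices, fun y hy => ?_⟩, rfl,
        le_rfl⟩
      have := le_of_mem_convexHull (l := -C) (M := -C x) (fun z hz => neg_le_neg (hopt z hz)) hy
      exact neg_le_neg_iff.1 this
  | succ k ih =>
    intro t x hx hk
    by_cases hopt : ∃ z ∈ S, C z < C x
    · obtain ⟨y, t', htt', hy, hyc, hedge, hmem, hnot⟩ := exists_pivot hS hx (hgen x hx.1) hopt
      have hlt : (directionsAbove (convexHull ℝ S) l C t').ncard <
          (directionsAbove (convexHull ℝ S) l C t).ncard := by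
        refine Set.ncard_lt_ncard ⟨?_, fun hsub => hnot (hsub hmem)⟩ (hfin t)
        -- `directionsAbove` shrinks as `t` grows because `c d > 0`.
        rintro L ⟨hL, d, hd, hcd, hld⟩
        exact ⟨hL, d, hd, hcd, by nlinarith⟩
      obtain ⟨p, hp, hhead, hlen⟩ := ih t' y hy (by omega)
      have hrel : (x, p.head) ∈ improvingEdges (convexHull ℝ S) c := by
        rw [hhead]
        exact ⟨hedge, hyc⟩
      refine ⟨p.cons x hrel, ⟨?_, ?_⟩, p.head_cons x hrel, ?_⟩
      · rw [p.head_cons x hrel]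
        exact hx.mem_vertices
      · rw [p.last_cons x hrel]
        exact hp.2
      · rw [p.cons_length x hrel]
        omega
    · push Not at hopt
      refine ⟨RelSeries.singleton _ x, ⟨hx.mem_vertices, hx.mem_vertices, fun y hy => ?_⟩, rfl,
        Nat.zero_le _⟩
      have := le_of_mem_convexHull (l := -C) (M := -C x) (fun z hz => neg_le_neg (hopt z hz)) hy
      exact neg_le_neg_iff.1 this

/-- From every vertex of a polytope there is a monotone path with at most as many edges as the
polytope has edge directions. -/
theorem exists_isMonotonePath {P : Set (Fin n → ℝ)} (hP : IsPolytope P) (c : Fin n → ℝ)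
    {x : Fin n → ℝ} (hx : x ∈ vertices P) :
    ∃ p : RelSeries (improvingEdges P c),
      IsMonotonePath P c p ∧ p.head = x ∧ p.length ≤ (edgeDirections P).ncard := by
  obtain ⟨S, hS, rfl⟩ := hP
  obtain ⟨l, hl, hgen⟩ := exists_isStrictMaximizer_generic hS hx
    ((fun a : (Fin n → ℝ) × (Fin n → ℝ) × (Fin n → ℝ) =>
      (c ⬝ᵥ a.1 - c ⬝ᵥ a.2.2) • (a.1 - a.2.1) - (c ⬝ᵥ a.1 - c ⬝ᵥ a.2.1) • (a.1 - a.2.2)) ''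
      (S ×ˢ S ×ˢ S)) ((hS.prod (hS.prod hS)).image _)
  -- The rotation starts at `t = 0`, where `l` itself exposes `x`.
  refine exists_improving_path_aux hS (l := l) (fun x hx z hz z' hz' => ?_) _ 0 x
    (by simpa using hl)
    (Set.ncard_le_ncard (Set.sep_subset _ _) (finite_edgeDirections hS))
  exact hgen _ ⟨(x, z, z'), ⟨hx, hz, hz'⟩, rfl⟩

end MonotonePath

/-! ### Edge directions, generic objectives and diameters -/

section MonotoneDiameter

variable {n : ℕ}

/-- By minimality each `e` is the only member of `E` spanning some edge direction; otherwise it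
could be erased. -/
theorem edgeDirections_eq_image_and_injOn {P : Set (Fin n → ℝ)} {E : Finset (Fin n → ℝ)}
    (hE : Minimal (ContainsEdgeDirections P) E) :
    (fun e => Submodule.span ℝ {e}) '' (E : Set (Fin n → ℝ)) = edgeDirections P ∧
      Set.InjOn (fun e : Fin n → ℝ => Submodule.span ℝ {e}) E := by
  classical
  have key : ∀ e ∈ E, ∃ L ∈ edgeDirections P, ∀ e' ∈ E, Submodule.span ℝ {e'} = L → e' = e := by
    intro e he
    by_contra! h
    have hcon : ContainsEdgeDirections P (E.erase e) := fun L hL => by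
      obtain ⟨e', he', hspan, hne⟩ := h L hL
      exact ⟨e', Finset.mem_erase.2 ⟨hne, he'⟩, hspan⟩
    exact Finset.notMem_erase e E (hE.2 hcon (Finset.erase_subset e E) he)
  have key' : ∀ e ∈ E, Submodule.span ℝ {e} ∈ edgeDirections P ∧
      ∀ e' ∈ E, Submodule.span ℝ {e'} = Submodule.span ℝ {e} → e' = e := by
    intro e he
    obtain ⟨L, hL, huniq⟩ := key e he
    obtain ⟨e', he', rfl⟩ := hE.1 L hL
    obtain rfl := huniq e' he' rfl
    exact ⟨hL, huniq⟩
  refine ⟨Set.Subset.antisymm ?_ fun L hL => ?_, fun e he e' he' h => (key' e' he').2 e he h⟩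
  · rintro _ ⟨e, he, rfl⟩
    exact (key' e he).1
  · obtain ⟨e, he, h⟩ := hE.1 L hL
    exact ⟨e, he, h⟩

theorem bot_notMem_edgeDirections {P : Set (Fin n → ℝ)} : ⊥ ∉ edgeDirections P := by
  rintro ⟨u, v, h, hbot⟩
  exact h.2.2.1 (sub_eq_zero.1 (Submodule.span_singleton_eq_bot.1 hbot.symm)).symm

theorem finite_vertices {P : Set (Fin n → ℝ)} (hP : IsPolytope P) : (vertices P).Finite := by
  obtain ⟨S, hS, rfl⟩ := hP
  exact hS.subset vertices_convexHull_subset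

/-- A functional that separates the generating points has a unique maximizer among them. -/
theorem vertices_nonempty {P : Set (Fin n → ℝ)} (hP : IsPolytope P) (hne : P.Nonempty) :
    (vertices P).Nonempty := by
  obtain ⟨S, hS, rfl⟩ := hP
  obtain ⟨g, hg⟩ := exists_dual_ne_zero_on
    ((fun a : (Fin n → ℝ) × (Fin n → ℝ) => a.1 - a.2) '' (S ×ˢ S)) ((hS.prod hS).image _)
  obtain ⟨x, hx, hmax⟩ := Set.exists_max_image S g hS (convexHull_nonempty_iff.1 hne)
  refine ⟨x, IsStrictMaximizer.mem_vertices (l := g) ⟨hx, fun y hy hyx => ?_⟩⟩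
  refine lt_of_le_of_ne (hmax y hy) fun h => ?_
  exact hg _ ⟨(y, x), ⟨hy, hx⟩, rfl⟩ (sub_ne_zero.2 hyx) (by simp [h])

theorem monotoneDiameter_le {P : Set (Fin n → ℝ)} {N : ℕ∞}
    (h : ∀ c, IsNondegenerate P c → ∀ x ∈ vertices P, ∃ p : RelSeries (improvingEdges P c),
      IsMonotonePath P c p ∧ p.head = x ∧ (p.length : ℕ∞) ≤ N) : monotoneDiameter P ≤ N := by
  refine iSup₂_le fun c hc => iSup₂_le fun x hx => ?_
  obtain ⟨p, hp, hhead, hlen⟩ := h c hc x hx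
  exact (iInf₂_le p ⟨hp, hhead⟩).trans hlen

theorem monotoneDiameter_le_encard_edgeDirections {P : Set (Fin n → ℝ)} (hP : IsPolytope P) :
    monotoneDiameter P ≤ (edgeDirections P).encard := by
  refine monotoneDiameter_le fun c _ x hx => ?_
  obtain ⟨p, hp, hhead, hlen⟩ := exists_isMonotonePath hP c hx
  refine ⟨p, hp, hhead, (Nat.cast_le.2 hlen).trans ?_⟩
  obtain ⟨S, hS, rfl⟩ := hP
  rw [(finite_edgeDirections hS).cast_ncard_eq]

/-- Both requirements ask `c` to be nonzero on finitely many nonzero vectors: those of `W` and the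
differences of vertices. -/
theorem exists_generic_objective {P : Set (Fin n → ℝ)} (hP : IsPolytope P)
    (W : Set (Fin n → ℝ)) (hW : W.Finite) :
    ∃ c, IsNondegenerate P c ∧ ∀ w ∈ W, w ≠ 0 → c ⬝ᵥ w ≠ 0 := by
  have hV := finite_vertices hP
  obtain ⟨g, hg⟩ := exists_dual_ne_zero_on
    (W ∪ (fun a : (Fin n → ℝ) × (Fin n → ℝ) => a.1 - a.2) '' (vertices P ×ˢ vertices P))
    (hW.union ((hV.prod hV).image _))
  have hc : ∀ w, (dotProductEquiv ℝ (Fin n)).symm g.toLinearMap ⬝ᵥ w = g w := fun w =>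
    LinearMap.congr_fun ((dotProductEquiv ℝ (Fin n)).apply_symm_apply g.toLinearMap) w
  refine ⟨_, fun x hx y hy hxy => ?_, fun w hw h0 => by
    rw [hc]; exact hg w (Or.inl hw) h0⟩
  by_contra hne
  refine hg _ (Or.inr ⟨(x, y), ⟨hx, hy⟩, rfl⟩) (sub_ne_zero.2 hne) ?_
  dsimp only at hxy
  rw [hc, hc] at hxy
  rw [map_sub, hxy, sub_self]

theorem monotoneDiameter_zonotope {ι : Type*} [Fintype ι] {v : ι → (Fin n → ℝ)}
    (hv : ∀ i, v i ≠ 0) (hpar : Function.Injective fun i => Submodule.span ℝ {v i}) :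
    monotoneDiameter (zonotope v) = Fintype.card ι := by
  have hP := isPolytope_zonotope v
  refine le_antisymm (monotoneDiameter_le fun c _ x hx => ?_) ?_
  -- Existence of a path matters here, as the distance would be `⊤` without one; its length is then
  -- bounded by the potential.
  · obtain ⟨p, hp, hhead, -⟩ := exists_isMonotonePath hP c hx
    exact ⟨p, hp, hhead, Nat.cast_le.2 (length_le_card_of_zonotope p)⟩
  obtain ⟨c, hc, hcv⟩ := exists_generic_objective hP (Set.range v) (Set.finite_range v)
  -- the starting vertex is the optimum for the opposite objective function
  obtain ⟨z, hz⟩ := vertices_nonempty hP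
    ⟨0, mem_zonotope_iff.2 ⟨0, fun i => ⟨le_rfl, zero_le_one⟩, by simp⟩⟩
  obtain ⟨q, hq, -⟩ := exists_isMonotonePath hP (-c) hz
  have hmax : ∀ y ∈ zonotope v, c ⬝ᵥ y ≤ c ⬝ᵥ q.last := fun y hy => by
    simpa using hq.2.2 y hy
  refine le_trans ?_ (le_iSup₂_of_le c hc (le_iSup₂_of_le q.last hq.2.1 le_rfl))
  exact le_iInf₂ fun p hp => Nat.cast_le.2 (card_le_length_of_zonotope hv hpar
    (fun i => hcv _ ⟨i, rfl⟩ (hv i)) (exposedPoints_subset hq.2.1) hmax p hp.1 hp.2)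

end MonotoneDiameter

theorem theorem1 (n : ℕ) :
    (∀ P : Set (Fin n → ℝ), IsPolytope P →
      ∀ E : Finset (Fin n → ℝ), Minimal (ContainsEdgeDirections P) E →
        monotoneDiameter P ≤ monotoneDiameter (zonotope (fun e : E => (e : Fin n → ℝ))) ∧
        monotoneDiameter (zonotope (fun e : E => (e : Fin n → ℝ))) =
          (edgeDirections P).encard) ∧
    (∀ (m : ℕ) (v : Fin m → (Fin n → ℝ)) (c : Fin n → ℝ),
      IsNondegenerate (zonotope v) c →
        ∀ p : RelSeries (improvingEdges (zonotope v) c),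
          IsMonotonePath (zonotope v) c p → p.length ≤ m) := by
  refine ⟨fun P hP E hE => ?_, fun m v c _ p _ => by simpa using length_le_card_of_zonotope p⟩
  obtain ⟨himage, hinj⟩ := edgeDirections_eq_image_and_injOn hE
  have hZ : monotoneDiameter (zonotope (fun e : E => (e : Fin n → ℝ))) =
      (edgeDirections P).encard := by
    rw [monotoneDiameter_zonotope, ← himage, hinj.encard_image, Set.encard_coe_eq_coe_finsetCard,
      Fintype.card_coe]
    · intro e h0
      refine bot_notMem_edgeDirections (P := P) ?_
      rw [← himage]
      exact ⟨e, e.2, by simp [h0]⟩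
    · exact fun e e' h => Subtype.ext (hinj e.2 e'.2 h)
  exact ⟨hZ ▸ monotoneDiameter_le_encard_edgeDirections hP, hZ⟩
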